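/- Let $R$ be a commutative Noetherian ring and let $\Phi$ be a system of ideals of $R$, that is, a non-empty set of ideals of $R$ such that for all $\mathfrak a_1,\mathfrak a_2\in\Phi$ there is $\mathfrak b\in\Phi$ with $\mathfrak b\subseteq\mathfrak a_1\mathfrak a_2$. For an $R$-module $M$ put $$\Gamma_\Phi(M)=\{x\in M \mid \mathfrak a x=0 \text{ for some } \mathfrak a\in\Phi\},$$ and for $i\ge 0$ let $H^i_\Phi$ denote the $i$-th right derived functor of the functor $\Gamma_\Phi$ on the category of $R$-modules. Let $N$ be a finitely generated $R$-module that is $\Phi$-torsion, i.e. $\Gamma_\Phi(N)=N$, let $M$ be an arbitrary $R$-module, and let $s,t$ be non-negative integers. Assume that (i) $\operatorname{Ext}^{s+t-i}_R(N,H^i_\Phi(M))=0$ for all $i$ with $0\le i<t$ or $t+1\le i\le s+t$; (ii) $\operatorname{Ext}^{s+1+i}_R(N,H^{t-i}_\Phi(M))=0$ for all $i$ with $0\le i\le t$; (iii) $\operatorname{Ext}^{s-1-i}_R(N,H^{t+i}_\Phi(M))=0$ for all $i$ with $0\le i\le s-1$. Then there is an isomorphism of $R$-modules $$\operatorname{Ext}^{s+t}_R(N,M)\cong\operatorname{Ext}^{s}_R(N,H^t_\Phi(M)).$$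 -/

import Mathlib

universe u v

open CategoryTheory

/-- A system of ideals of `R`: a non-empty set `Φ` of ideals such that for all `a₁, a₂ ∈ Φ` there is
`b ∈ Φ` with `b ⊆ a₁ a₂`. -/
structure SystemOfIdeals (R : Type u) [CommRing R] where
  /-- the underlying set of ideals -/
  ideals : Set (Ideal R)
  nonempty : ideals.Nonempty
  exists_le_mul : ∀ a₁ ∈ ideals, ∀ a₂ ∈ ideals, ∃ b ∈ ideals, b ≤ a₁ * a₂

namespace SystemOfIdeals

variable {R : Type u} [CommRing R] (Φ : SystemOfIdeals R)

/-- `Γ_Φ(M) = {x ∈ M | a x = 0 for some a ∈ Φ}`, as a submodule of `M`. -/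
def torsionSubmodule (M : Type v) [AddCommGroup M] [Module R M] : Submodule R M where
  carrier := {x | ∃ a ∈ Φ.ideals, ∀ r ∈ a, r • x = 0}
  zero_mem' := by
    obtain ⟨a, ha⟩ := Φ.nonempty
    exact ⟨a, ha, fun r _ => smul_zero r⟩
  add_mem' := by
    rintro x y ⟨a₁, h₁, hx⟩ ⟨a₂, h₂, hy⟩
    obtain ⟨b, hb, hle⟩ := Φ.exists_le_mul a₁ h₁ a₂ h₂
    have h1 : b ≤ a₁ := hle.trans (Ideal.mul_le_inf.trans inf_le_left)
    have h2 : b ≤ a₂ := hle.trans (Ideal.mul_le_inf.trans inf_le_right)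
    refine ⟨b, hb, fun r hr => ?_⟩
    rw [smul_add, hx r (h1 hr), hy r (h2 hr), add_zero]
  smul_mem' := by
    rintro c x ⟨a, ha, hx⟩
    refine ⟨a, ha, fun r hr => ?_⟩
    rw [smul_comm, hx r hr, smul_zero]

/-- `M` is `Φ`-torsion if `Γ_Φ(M) = M`. -/
def IsTorsion (M : Type v) [AddCommGroup M] [Module R M] : Prop :=
  Φ.torsionSubmodule M = ⊤

theorem map_mem_torsionSubmodule {M M' : Type v} [AddCommGroup M] [Module R M]
    [AddCommGroup M'] [Module R M'] (f : M →ₗ[R] M') {x : M} (hx : x ∈ Φ.torsionSubmodule M) :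
    f x ∈ Φ.torsionSubmodule M' := by
  obtain ⟨a, ha, h⟩ := hx
  exact ⟨a, ha, fun r hr => by rw [← map_smul, h r hr, map_zero]⟩

/-- The functor `Γ_Φ` from `R`-modules to `R`-modules; on morphisms it is restriction. -/
def torsionFunctor : ModuleCat.{v} R ⥤ ModuleCat.{v} R where
  obj M := ModuleCat.of R (Φ.torsionSubmodule M)
  map f := ModuleCat.ofHom
    (f.hom.restrict fun _ hx => Φ.map_mem_torsionSubmodule f.hom hx)

instance torsionFunctor_additive : (torsionFunctor.{u, v} Φ).Additive where

/-- The `i`-th general local cohomology functor `H^i_Φ`: the `i`-th right derived functor of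
`Γ_Φ`. -/
noncomputable def localCohomology [Small.{v} R] (i : ℕ) : ModuleCat.{v} R ⥤ ModuleCat.{v} R :=
  (torsionFunctor.{u, v} Φ).rightDerived i

end SystemOfIdeals

/-!
By the Artin–Rees lemma `Γ_Φ` preserves injective modules. Hence for an injective resolution `I` of
`M` the complex `J = Γ_Φ(I)` consists of injectives and has cohomology `H^q_Φ(M)`. As `N` is
`Φ`-torsion, `Hom(N, J) = Hom(N, I)`, so this complex computes `Ext(N, M)`, and there is a spectral
sequence `Ext^a(N, H^q_Φ(M)) ⇒ Ext^{a+q}(N, M)`. The hypotheses kill all its terms of total degree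
`s + t` except the one at `(s, t)`, and all the differentials into or out of that term.

The spectral sequence is replaced by dimension shifting along `0 → Z^n → J^n → B^{n+1} → 0` and
`0 → B^n → Z^n → H^n → 0`: starting from `Ext^s(N, H^t)`, one passes to the cokernel of
`Ext^s(N, J^{t-1}) → Ext^s(N, Z^t)`, and then lowers the `Ext` degree while raising the degree of
the complex until the cokernel of `Hom(N, J^{s+t-1}) → Hom(N, Z^{s+t})` is reached.
-/

open Abelian Limits

universe w t u₁ v₁

section Ext

variable {C : Type u₁} [Category.{v₁} C] [Abelian C] [HasExt.{w} C]

lemma subsingleton_ext_of_isZero (N : C) {X : C} (hX : IsZero X) (n : ℕ) :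
    Subsingleton (Ext N X n) := by
  refine subsingleton_of_forall_eq 0 fun x => ?_
  rw [← Ext.comp_mk₀_id x, hX.eq_of_src (𝟙 X) 0, Ext.mk₀_zero, Ext.comp_zero]

section Linear

variable (R : Type t) [CommRing R] [Linear R C] (N : C)

/-- The `R`-linear map `Ext^n(N, f) : Ext^n(N, X) → Ext^n(N, Y)` induced by `f : X ⟶ Y`. -/
noncomputable def extMap {X Y : C} (f : X ⟶ Y) (n : ℕ) : Ext N X n →ₗ[R] Ext N Y n :=
  (Ext.mk₀ f).postcompOfLinear R N (add_zero n)

@[simp]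
lemma extMap_apply {X Y : C} (f : X ⟶ Y) {n : ℕ} (x : Ext N X n) :
    extMap R N f n x = x.comp (Ext.mk₀ f) (add_zero n) :=
  rfl

lemma extMap_comp {X Y Z : C} (f : X ⟶ Y) (g : Y ⟶ Z) (n : ℕ) :
    extMap R N (f ≫ g) n = extMap R N g n ∘ₗ extMap R N f n := by
  ext x
  simp

/-- The linear equivalence `Ext^n(N, X) ≃ Ext^n(N, Y)` induced by an isomorphism `X ≅ Y`. -/
noncomputable def extEquivOfIso {X Y : C} (e : X ≅ Y) (n : ℕ) : Ext N X n ≃ₗ[R] Ext N Y n :=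
  LinearEquiv.ofLinearMap (extMap R N e.hom n) (extMap R N e.inv n)
    (by ext x; simp) (by ext x; simp)

variable {N} in
lemma bijective_extMap_zero {X Y : C} {f : X ⟶ Y}
    (hf : Function.Bijective fun g : N ⟶ X => g ≫ f) :
    Function.Bijective (extMap R N f 0) := by
  have h : extMap R N f 0 ∘ Ext.addEquiv₀.symm = Ext.addEquiv₀.symm ∘ (fun g : N ⟶ X => g ≫ f) := by
    ext g
    simp
  rw [← Function.Bijective.of_comp_iff _ Ext.addEquiv₀.symm.bijective, h]
  exact Ext.addEquiv₀.symm.bijective.comp hf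

end Linear

section ShortExact

variable {S : ShortComplex C} (hS : S.ShortExact) (N : C)
include hS

lemma subsingleton_ext_middle {n : ℕ} (h₁ : Subsingleton (Ext N S.X₁ n))
    (h₃ : Subsingleton (Ext N S.X₃ n)) : Subsingleton (Ext N S.X₂ n) := by
  refine subsingleton_of_forall_eq 0 fun x => ?_
  obtain ⟨y, rfl⟩ := Ext.covariant_sequence_exact₂ N hS x (h₃.elim _ _)
  rw [h₁.elim y 0, Ext.zero_comp]

lemma subsingleton_ext_right {n : ℕ} (h₂ : Subsingleton (Ext N S.X₂ n))
    (h₁ : Subsingleton (Ext N S.X₁ (n + 1))) : Subsingleton (Ext N S.X₃ n) := by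
  refine subsingleton_of_forall_eq 0 fun x => ?_
  obtain ⟨y, rfl⟩ := Ext.covariant_sequence_exact₃ N hS x rfl (h₁.elim _ _)
  rw [h₂.elim y 0, Ext.zero_comp]

variable (R : Type t) [CommRing R] [Linear R C]

lemma extMap_g_surjective {n : ℕ} (h₁ : Subsingleton (Ext N S.X₁ (n + 1))) :
    Function.Surjective (extMap R N S.g n) :=
  fun x => Ext.covariant_sequence_exact₃ N hS x rfl (h₁.elim _ _)

lemma ker_extMap_g (n : ℕ) :
    LinearMap.ker (extMap R N S.g n) = LinearMap.range (extMap R N S.f n) := by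
  ext x
  refine ⟨Ext.covariant_sequence_exact₂ N hS x, ?_⟩
  rintro ⟨y, rfl⟩
  simp

lemma bijective_extMap_f {n : ℕ} (h₃ : Subsingleton (Ext N S.X₃ n))
    (h₃' : ∀ m, m + 1 = n → Subsingleton (Ext N S.X₃ m)) :
    Function.Bijective (extMap R N S.f n) := by
  refine ⟨?_, fun x => Ext.covariant_sequence_exact₂ N hS x (h₃.elim _ _)⟩
  cases n with
  | zero =>
    have := hS.mono_f
    exact Ext.postcomp_mk₀_injective_of_mono N S.f
  | succ m =>
    refine (injective_iff_map_eq_zero _).2 fun x hx => ?_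
    obtain ⟨y, rfl⟩ := Ext.covariant_sequence_exact₁ N hS x hx rfl
    rw [(h₃' m rfl).elim y 0, Ext.zero_comp]

lemma ker_postcomp_extClass (n : ℕ) :
    LinearMap.ker (hS.extClass.postcompOfLinear R N (rfl : n + 1 = n + 1)) =
      LinearMap.range (extMap R N S.g n) := by
  ext x
  refine ⟨Ext.covariant_sequence_exact₃ N hS x rfl, ?_⟩
  rintro ⟨y, rfl⟩
  simp

/-- Dimension shifting: if `Ext^{n+1}(N, S.X₂) = 0`, the connecting map identifies the cokernel of
`Ext^n(N, S.g)` with `Ext^{n+1}(N, S.X₁)`. -/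
noncomputable def cokerExtMapGEquiv {n : ℕ} (h₂ : Subsingleton (Ext N S.X₂ (n + 1))) :
    (Ext N S.X₃ n ⧸ LinearMap.range (extMap R N S.g n)) ≃ₗ[R] Ext N S.X₁ (n + 1) :=
  (Submodule.quotEquivOfEq _ _ (ker_postcomp_extClass hS N R n).symm).trans <|
    (hS.extClass.postcompOfLinear R N rfl).quotKerEquivOfSurjective
      fun x => Ext.covariant_sequence_exact₁ N hS x (h₂.elim _ _) rfl

end ShortExact

end Ext

section Complex

variable {C : Type u₁} [Category.{v₁} C] [Abelian C] (K : CochainComplex C ℕ)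

/-- The object `B^n(K)` of boundaries, as the kernel of `Z^n(K) ⟶ H^n(K)`. -/
noncomputable abbrev boundaries (n : ℕ) : C :=
  kernel (K.homologyπ n)

/-- The factorization of the differential `K^m ⟶ K^n` through `B^n(K)`. -/
noncomputable abbrev toBoundaries (m n : ℕ) : K.X m ⟶ boundaries K n :=
  kernel.lift _ (K.toCycles m n) (K.toCycles_comp_homologyπ m n)

lemma isZero_boundaries_zero : IsZero (boundaries K 0) :=
  isZero_kernel_of_mono _

lemma epi_toBoundaries {m n : ℕ} (hm : (ComplexShape.up ℕ).prev n = m) :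
    Epi (toBoundaries K m n) :=
  (ShortComplex.exact_of_g_is_cokernel
    (.mk (K.toCycles m n) (K.homologyπ n) (K.toCycles_comp_homologyπ m n))
    (K.homologyIsCokernel m n hm)).epi_kernelLift

/-- The sequence `0 ⟶ B^n(K) ⟶ Z^n(K) ⟶ H^n(K) ⟶ 0`. -/
noncomputable abbrev boundariesSequence (n : ℕ) : ShortComplex C :=
  .mk (kernel.ι (K.homologyπ n)) (K.homologyπ n) (kernel.condition _)

lemma boundariesSequence_shortExact (n : ℕ) : (boundariesSequence K n).ShortExact where
  exact := ShortComplex.exact_kernel _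

/-- The sequence `0 ⟶ Z^n(K) ⟶ K^n ⟶ B^{n+1}(K) ⟶ 0`. -/
noncomputable abbrev cyclesSequence (n : ℕ) : ShortComplex C :=
  .mk (K.iCycles n) (toBoundaries K n (n + 1)) (by
    rw [← cancel_mono (kernel.ι _), ← cancel_mono (K.iCycles (n + 1))]
    simp)

lemma cyclesSequence_shortExact (n : ℕ) : (cyclesSequence K n).ShortExact where
  epi_g := epi_toBoundaries K (by simp)
  exact := by
    let φ : cyclesSequence K n ⟶ .mk (K.iCycles n) (K.d n (n + 1)) (K.iCycles_d n (n + 1)) :=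
      { τ₁ := 𝟙 _, τ₂ := 𝟙 _, τ₃ := kernel.ι _ ≫ K.iCycles _ }
    have : Epi φ.τ₁ := inferInstanceAs (Epi (𝟙 _))
    have : IsIso φ.τ₂ := inferInstanceAs (IsIso (𝟙 _))
    have : Mono φ.τ₃ := inferInstanceAs (Mono (kernel.ι _ ≫ K.iCycles _))
    exact (ShortComplex.exact_iff_of_epi_of_isIso_of_mono φ).2
      (ShortComplex.exact_of_f_is_kernel _ (K.cyclesIsKernel n (n + 1) (by simp)))

variable {K} in
lemma bijective_comp_cyclesMap {L : CochainComplex C ℕ} {φ : K ⟶ L} {N : C}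
    (hφ : ∀ i, Function.Bijective fun f : N ⟶ K.X i => f ≫ φ.f i) (n : ℕ) :
    Function.Bijective fun f : N ⟶ K.cycles n => f ≫ HomologicalComplex.cyclesMap φ n := by
  refine ⟨fun f g hfg => ?_, fun f => ?_⟩
  · rw [← cancel_mono (K.iCycles n)]
    apply (hφ n).1
    simpa using congr($hfg ≫ L.iCycles n)
  · obtain ⟨g, hg : g ≫ φ.f n = f ≫ L.iCycles n⟩ := (hφ n).2 (f ≫ L.iCycles n)
    have hgd : g ≫ K.d n (n + 1) = 0 := (hφ (n + 1)).1 <| by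
      simp only [Category.assoc, zero_comp]
      rw [← φ.comm, reassoc_of% hg, L.iCycles_d, comp_zero]
    refine ⟨K.liftCycles g (n + 1) (by simp) hgd, ?_⟩
    simp [← cancel_mono (L.iCycles n), hg]

variable [HasExt.{w} C]

section Vanishing

variable {K} {N : C} (hK : ∀ i p, Subsingleton (Ext N (K.X i) (p + 1)))
include hK

lemma subsingleton_ext_cycles {n p : ℕ}
    (h : ∀ a q, a + q = p + 1 + n → q ≤ n → Subsingleton (Ext N (K.homology q) a)) :
    Subsingleton (Ext N (K.cycles n) (p + 1)) := by
  refine subsingleton_ext_middle (boundariesSequence_shortExact K n) N ?_ (h _ n rfl le_rfl)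
  induction n generalizing p with
  | zero => exact subsingleton_ext_of_isZero N (isZero_boundaries_zero K) _
  | succ n ih =>
    refine subsingleton_ext_right (cyclesSequence_shortExact K n) N (hK n p) ?_
    exact subsingleton_ext_middle (boundariesSequence_shortExact K n) N
      (ih fun a q ha hq => h a q (by lia) (by lia)) (h _ n (by lia) (by lia))

lemma subsingleton_ext_boundaries {n p : ℕ}
    (h : ∀ a q, a + q = p + 1 + n → q < n → Subsingleton (Ext N (K.homology q) a)) :
    Subsingleton (Ext N (boundaries K n) (p + 1)) := by
  cases n with
  | zero => exact subsingleton_ext_of_isZero N (isZero_boundaries_zero K) _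
  | succ n =>
    exact subsingleton_ext_right (cyclesSequence_shortExact K n) N (hK n p)
      (subsingleton_ext_cycles hK fun a q ha hq => h a q (by lia) (by lia))

lemma extMap_toBoundaries_surjective (R : Type t) [CommRing R] [Linear R C] {m n p : ℕ}
    (hm : (ComplexShape.up ℕ).prev n = m)
    (h : ∀ a q, a + q = p + n → q < n → Subsingleton (Ext N (K.homology q) a)) :
    Function.Surjective (extMap R N (toBoundaries K m n) p) := by
  cases n with
  | zero =>
    have := subsingleton_ext_of_isZero.{w} N (isZero_boundaries_zero K) p
    exact Function.surjective_to_subsingleton _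
  | succ n =>
    obtain rfl : n = m := by simpa using hm
    exact extMap_g_surjective (cyclesSequence_shortExact K n) N R
      (subsingleton_ext_cycles hK fun a q ha hq => h a q (by lia) (by lia))

end Vanishing

variable (R : Type t) [CommRing R] [Linear R C] (N : C)

/-- The cokernel of `Ext^p(N, K^{n-1}) → Ext^p(N, Z^n(K))`. It is the cohomology of the complex
`Hom(N, K)` in degree `n` if `p = 0`, and `Ext^p(N, Z^n(K))` if `Ext^p(N, K^{n-1}) = 0`. In degree
`n = 0`, where the library sets `prev 0 = 0`, the map `K.toCycles 0 0` is zero. -/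
abbrev CyclesExt (n p : ℕ) : Type w :=
  Ext N (K.cycles n) p ⧸
    LinearMap.range (extMap R N (K.toCycles ((ComplexShape.up ℕ).prev n) n) p)

lemma range_extMap_toCycles (m n p : ℕ) :
    LinearMap.range (extMap R N (K.toCycles m n) p) =
      (LinearMap.range (extMap R N (toBoundaries K m n) p)).map
        (extMap R N (kernel.ι (K.homologyπ n)) p) := by
  rw [← LinearMap.range_comp, ← extMap_comp, kernel.lift_ι]

variable {K N}

lemma nonempty_cyclesExt_equiv_ext_homology {n p : ℕ}
    (hB : Subsingleton (Ext N (boundaries K n) (p + 1)))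
    (hX : Function.Surjective
      (extMap R N (toBoundaries K ((ComplexShape.up ℕ).prev n) n) p)) :
    Nonempty (CyclesExt K R N n p ≃ₗ[R] Ext N (K.homology n) p) := by
  have hS := boundariesSequence_shortExact K n
  have hker : LinearMap.range (extMap R N (K.toCycles ((ComplexShape.up ℕ).prev n) n) p) =
      LinearMap.ker (extMap R N (K.homologyπ n) p) := by
    rw [range_extMap_toCycles, LinearMap.range_eq_top.2 hX, Submodule.map_top]
    exact (ker_extMap_g hS N R p).symm
  exact ⟨(Submodule.quotEquivOfEq _ _ hker).trans
    (LinearMap.quotKerEquivOfSurjective _ (extMap_g_surjective hS N R hB))⟩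

section Acyclic

variable (hK : ∀ i p, Subsingleton (Ext N (K.X i) (p + 1)))
include hK

lemma nonempty_cyclesExt_equiv_succ {n p : ℕ}
    (h : Subsingleton (Ext N (K.homology (n + 1)) p))
    (h' : ∀ a, a + 1 = p → Subsingleton (Ext N (K.homology (n + 1)) a)) :
    Nonempty (CyclesExt K R N n (p + 1) ≃ₗ[R] CyclesExt K R N (n + 1) p) := by
  let δ := cokerExtMapGEquiv (cyclesSequence_shortExact K n) N R (hK n p)
  let ι := LinearEquiv.ofBijective _
    (bijective_extMap_f (boundariesSequence_shortExact K (n + 1)) N R h h')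
  have hbot : LinearMap.range
      (extMap R N (K.toCycles ((ComplexShape.up ℕ).prev n) n) (p + 1)) = ⊥ :=
    have := hK ((ComplexShape.up ℕ).prev n) p
    LinearMap.range_eq_bot.2 (Subsingleton.elim _ _)
  have hrange : (LinearMap.range (extMap R N (toBoundaries K n (n + 1)) p)).map ι.toLinearMap =
      LinearMap.range
        (extMap R N (K.toCycles ((ComplexShape.up ℕ).prev (n + 1)) (n + 1)) p) := by
    rw [CochainComplex.prev_nat_succ, range_extMap_toCycles]
    rfl
  exact ⟨(Submodule.quotEquivOfEqBot _ hbot).trans <|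
    δ.symm.trans (Submodule.Quotient.equiv _ _ ι hrange)⟩

lemma nonempty_cyclesExt_equiv_cyclesExt_zero {n p : ℕ}
    (h : ∀ a q, a + q = p + n → n < q → Subsingleton (Ext N (K.homology q) a))
    (h' : ∀ a q, a + q + 1 = p + n → n < q → Subsingleton (Ext N (K.homology q) a)) :
    Nonempty (CyclesExt K R N n p ≃ₗ[R] CyclesExt K R N (p + n) 0) := by
  induction p generalizing n with
  | zero =>
    rw [zero_add]
    exact ⟨.refl _ _⟩
  | succ p ih =>
    obtain ⟨e⟩ := nonempty_cyclesExt_equiv_succ R hK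
      (h p (n + 1) (by lia) (by lia)) fun a ha => h' a (n + 1) (by lia) (by lia)
    obtain ⟨e'⟩ := ih (n := n + 1) (fun a q ha hq => h a q (by lia) (by lia))
      fun a q ha hq => h' a q (by lia) (by lia)
    rw [show p + 1 + n = p + (n + 1) by lia]
    exact ⟨e.trans e'⟩

theorem nonempty_cyclesExt_zero_equiv_ext_homology (s t : ℕ)
    (h₁ : ∀ a q, a + q = s + t → q ≠ t → Subsingleton (Ext N (K.homology q) a))
    (h₂ : ∀ a q, a + q = s + t + 1 → q < t → Subsingleton (Ext N (K.homology q) a))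
    (h₃ : ∀ a q, a + q + 1 = s + t → t < q → Subsingleton (Ext N (K.homology q) a)) :
    Nonempty (CyclesExt K R N (s + t) 0 ≃ₗ[R] Ext N (K.homology t) s) := by
  obtain ⟨e⟩ := nonempty_cyclesExt_equiv_cyclesExt_zero R hK
    (fun a q ha hq => h₁ a q ha hq.ne') h₃
  obtain ⟨e'⟩ := nonempty_cyclesExt_equiv_ext_homology R
    (subsingleton_ext_boundaries hK fun a q ha hq => h₂ a q (by lia) hq)
    (extMap_toBoundaries_surjective hK R rfl fun a q ha hq => h₁ a q ha hq.ne)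
  exact ⟨e.symm.trans e'⟩

end Acyclic

lemma nonempty_cyclesExt_zero_equiv_of_bijective {L : CochainComplex C ℕ} {φ : K ⟶ L}
    (hφ : ∀ i, Function.Bijective fun f : N ⟶ K.X i => f ≫ φ.f i) (n : ℕ) :
    Nonempty (CyclesExt K R N n 0 ≃ₗ[R] CyclesExt L R N n 0) := by
  set m := (ComplexShape.up ℕ).prev n
  have hX := bijective_extMap_zero R (hφ m)
  have hZ := bijective_extMap_zero R (bijective_comp_cyclesMap hφ n)
  refine ⟨Submodule.Quotient.equiv _ _ (LinearEquiv.ofBijective _ hZ) ?_⟩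
  have hcomm : K.toCycles m n ≫ HomologicalComplex.cyclesMap φ n = φ.f m ≫ L.toCycles m n := by
    rw [← cancel_mono (L.iCycles n)]
    simp
  calc (LinearMap.range (extMap R N (K.toCycles m n) 0)).map
        (extMap R N (HomologicalComplex.cyclesMap φ n) 0)
    _ = LinearMap.range (extMap R N (φ.f m ≫ L.toCycles m n) 0) := by
      rw [← LinearMap.range_comp, ← extMap_comp, hcomm]
    _ = LinearMap.range (extMap R N (L.toCycles m n) 0) := by
      rw [extMap_comp, LinearMap.range_comp_of_range_eq_top _ (LinearMap.range_eq_top.2 hX.2)]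

lemma nonempty_cyclesExt_zero_equiv_ext {M : C} (I : InjectiveResolution M) (n : ℕ) :
    Nonempty (CyclesExt I.cocomplex R N n 0 ≃ₗ[R] Ext N M n) := by
  have hH (a q : ℕ) (hq : q ≠ 0) : Subsingleton (Ext N (I.cocomplex.homology q) a) := by
    obtain ⟨q, rfl⟩ := Nat.exists_eq_succ_of_ne_zero hq
    exact subsingleton_ext_of_isZero N (I.cocomplex_exactAt_succ q).isZero_homology a
  have hH₀ : M ≅ I.cocomplex.homology 0 :=
    (HomologicalComplex.singleObjHomologySelfIso _ _ _).symm ≪≫ isoOfQuasiIsoAt I.ι 0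
  obtain ⟨e⟩ := nonempty_cyclesExt_zero_equiv_ext_homology R
    (fun i p => Ext.subsingleton_of_injective N (I.cocomplex.X i) p) n 0
    (fun a q _ hq => hH a q hq) (fun _ _ _ hq => by lia) (fun a q _ hq => hH a q hq.ne')
  exact ⟨e.trans (extEquivOfIso R N hH₀.symm n)⟩

theorem nonempty_ext_equiv_ext_rightDerived [HasInjectiveResolutions C] {F : C ⥤ C} [F.Additive]
    [F.PreservesInjectiveObjects] (ι : F ⟶ 𝟭 C)
    (hι : ∀ X, Function.Bijective fun f : N ⟶ F.obj X => f ≫ ι.app X) (M : C) (s t : ℕ)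
    (h₁ : ∀ a q, a + q = s + t → q ≠ t → Subsingleton (Ext N ((F.rightDerived q).obj M) a))
    (h₂ : ∀ a q, a + q = s + t + 1 → q < t → Subsingleton (Ext N ((F.rightDerived q).obj M) a))
    (h₃ : ∀ a q, a + q + 1 = s + t → t < q → Subsingleton (Ext N ((F.rightDerived q).obj M) a)) :
    Nonempty (Ext N M (s + t) ≃ₗ[R] Ext N ((F.rightDerived t).obj M) s) := by
  let I := injectiveResolution M
  let J := (F.mapHomologicalComplex (ComplexShape.up ℕ)).obj I.cocomplex
  have hJ (i p : ℕ) : Subsingleton (Ext N (J.X i) (p + 1)) :=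
    have : Injective (J.X i) := F.injective_obj (I.cocomplex.X i)
    Ext.subsingleton_of_injective N (J.X i) p
  let φ : J ⟶ I.cocomplex :=
    { f i := ι.app (I.cocomplex.X i)
      comm' i j _ := (ι.naturality (I.cocomplex.d i j)).symm }
  let e (q a : ℕ) : Ext N (J.homology q) a ≃ₗ[R] Ext N ((F.rightDerived q).obj M) a :=
    extEquivOfIso R N (I.isoRightDerivedObj F q).symm a
  have hJH {q a : ℕ} (h : Subsingleton (Ext N ((F.rightDerived q).obj M) a)) :
      Subsingleton (Ext N (J.homology q) a) :=
    (e q a).injective.subsingleton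
  obtain ⟨e₁⟩ := nonempty_cyclesExt_zero_equiv_ext_homology R hJ s t
    (fun a q ha hq => hJH (h₁ a q ha hq))
    (fun a q ha hq => hJH (h₂ a q ha hq))
    (fun a q ha hq => hJH (h₃ a q ha hq))
  obtain ⟨e₂⟩ := nonempty_cyclesExt_zero_equiv_of_bijective R (φ := φ)
    (fun i => hι (I.cocomplex.X i)) (s + t)
  obtain ⟨e₃⟩ := nonempty_cyclesExt_zero_equiv_ext R (N := N) I (s + t)
  exact ⟨e₃.symm.trans <| e₂.symm.trans <| e₁.trans (e t s)⟩

end Complex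

section Baer

variable {R : Type u} [CommRing R]

lemma exists_pow_comap_le_ker [IsNoetherianRing R] {M : Type v} [AddCommGroup M] [Module R M]
    {I a : Ideal R} {f : I →ₗ[R] M} (ha : a ≤ (LinearMap.range f).annihilator) :
    ∃ k, Submodule.comap I.subtype (a ^ k) ≤ LinearMap.ker f := by
  obtain ⟨k, hk⟩ := Ideal.exists_pow_inf_eq_pow_smul a (I : Submodule R R)
  have hpow : a ^ (k + 1) ⊓ I ≤ a • I := by
    have h := hk (k + 1) (by lia)
    rw [Ideal.smul_eq_mul, Ideal.mul_top, Nat.add_sub_cancel_left, pow_one] at h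
    exact h.le.trans (Submodule.smul_mono le_rfl inf_le_right)
  have hker : a • I ≤ (LinearMap.ker f).map I.subtype :=
    Submodule.smul_le.2 fun r hr y hy => ⟨r • ⟨y, hy⟩,
      (map_smul f r _).trans (Submodule.mem_annihilator.1 (ha hr) _ ⟨_, rfl⟩), rfl⟩
  refine ⟨k + 1, fun x hx => ?_⟩
  obtain ⟨y, hy, hyx⟩ := hker (hpow ⟨hx, x.2⟩)
  rwa [← Subtype.ext hyx]

lemma exists_comp_eq_of_baer {M : Type v} [AddCommGroup M] [Module R M] (hM : Module.Baer R M)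
    {A B : Type u} [AddCommGroup A] [Module R A] [AddCommGroup B] [Module R B]
    (i : A →ₗ[R] B) (f : A →ₗ[R] M) (h : LinearMap.ker i ≤ LinearMap.ker f) :
    ∃ g : B →ₗ[R] M, g ∘ₗ i = f := by
  obtain ⟨g, hg⟩ := hM.extension_property ((LinearMap.ker i).liftQ i le_rfl)
    (LinearMap.ker_eq_bot.1 (Submodule.ker_liftQ_eq_bot _ _ _ le_rfl))
    ((LinearMap.ker i).liftQ f h)
  exact ⟨g, LinearMap.ext fun x => congr($hg (Submodule.Quotient.mk x))⟩

end Baer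

namespace SystemOfIdeals

variable {R : Type u} [CommRing R] (Φ : SystemOfIdeals R)

lemma exists_le_pow {a : Ideal R} (ha : a ∈ Φ.ideals) (k : ℕ) : ∃ b ∈ Φ.ideals, b ≤ a ^ k := by
  induction k with
  | zero => exact ⟨a, ha, by simp⟩
  | succ k ih =>
    obtain ⟨b, hb, hbk⟩ := ih
    obtain ⟨c, hc, hcb⟩ := Φ.exists_le_mul b hb a ha
    exact ⟨c, hc, hcb.trans (pow_succ a k ▸ Ideal.mul_mono_left hbk)⟩

lemma exists_le_annihilator {M : Type v} [AddCommGroup M] [Module R M] {P : Submodule R M}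
    (hP : P.FG) (hPΦ : P ≤ Φ.torsionSubmodule M) : ∃ a ∈ Φ.ideals, a ≤ P.annihilator := by
  induction P, hP using Submodule.fg_induction with
  | singleton x =>
    obtain ⟨a, ha, hax⟩ := hPΦ (Submodule.mem_span_singleton_self x)
    exact ⟨a, ha, fun r hr => (Submodule.mem_annihilator_span_singleton x r).2 (hax r hr)⟩
  | sup P Q _ _ hP hQ =>
    obtain ⟨a, ha, haP⟩ := hP (le_sup_left.trans hPΦ)
    obtain ⟨b, hb, hbQ⟩ := hQ (le_sup_right.trans hPΦ)
    obtain ⟨c, hc, hcab⟩ := Φ.exists_le_mul a ha b hb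
    refine ⟨c, hc, (hcab.trans Ideal.mul_le_inf).trans ?_⟩
    rw [Submodule.annihilator_sup]
    exact inf_le_inf haP hbQ

lemma baer_torsionSubmodule [IsNoetherianRing R] {M : Type v} [AddCommGroup M] [Module R M]
    (hM : Module.Baer R M) : Module.Baer R (Φ.torsionSubmodule M) := by
  intro I f
  let f' : I →ₗ[R] M := (Φ.torsionSubmodule M).subtype ∘ₗ f
  obtain ⟨a, ha, haf⟩ : ∃ a ∈ Φ.ideals, a ≤ (LinearMap.range f').annihilator :=
    Φ.exists_le_annihilator (Submodule.FG.of_finite)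
      (by rintro _ ⟨x, rfl⟩; exact (f x).2)
  obtain ⟨k, hk⟩ := exists_pow_comap_le_ker haf
  obtain ⟨b, hb, hbk⟩ := Φ.exists_le_pow ha k
  obtain ⟨g, hg⟩ := exists_comp_eq_of_baer hM ((a ^ k).mkQ ∘ₗ I.subtype) f'
    (by rwa [LinearMap.ker_comp, Submodule.ker_mkQ])
  have hgΦ (r : R) : g ((a ^ k).mkQ r) ∈ Φ.torsionSubmodule M := by
    refine ⟨b, hb, fun c hc => ?_⟩
    have hcr : (a ^ k).mkQ (c • r) = 0 :=
      (Submodule.Quotient.mk_eq_zero _).2 (Ideal.mul_mem_right r _ (hbk hc))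
    rw [← map_smul, ← map_smul, hcr, map_zero]
  exact ⟨(g ∘ₗ (a ^ k).mkQ).codRestrict _ hgΦ,
    fun x hx => Subtype.ext congr($hg ⟨x, hx⟩)⟩

instance [IsNoetherianRing R] [Small.{v} R] :
    (torsionFunctor.{u, v} Φ).PreservesInjectiveObjects where
  injective_obj {M} _ := by
    have : Module.Injective R M := Module.injective_module_of_injective_object R M
    have : Module.Injective R (Φ.torsionSubmodule M) :=
      (Φ.baer_torsionSubmodule (Module.Baer.of_injective this)).injective
    exact Module.injective_object_of_injective_module R _

/-- The inclusion of `Γ_Φ` in the identity functor. -/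
def torsionInclusion : torsionFunctor.{u, v} Φ ⟶ 𝟭 _ where
  app M := ModuleCat.ofHom (Φ.torsionSubmodule M).subtype

lemma bijective_comp_torsionInclusion {N : ModuleCat.{v} R} (hN : Φ.IsTorsion N)
    (M : ModuleCat.{v} R) :
    Function.Bijective fun f : N ⟶ Φ.torsionFunctor.obj M => f ≫ Φ.torsionInclusion.app M := by
  refine ⟨fun f g hfg => ?_, fun f => ⟨ModuleCat.ofHom (f.hom.codRestrict _ fun x =>
      Φ.map_mem_torsionSubmodule f.hom (hN ▸ Submodule.mem_top)), rfl⟩⟩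
  ext x
  exact Subtype.ext congr($(hfg).hom x)

end SystemOfIdeals

theorem theorem4p4_general {R : Type u} [CommRing R] [IsNoetherianRing R] [Small.{v} R]
    (Φ : SystemOfIdeals R) (N M : ModuleCat.{v} R) (hN : Φ.IsTorsion N) (s t : ℕ)
    (h₁ : ∀ i : ℕ, (i < t ∨ (t + 1 ≤ i ∧ i ≤ s + t)) →
      Subsingleton (Ext.{v} N ((Φ.localCohomology i).obj M) (s + t - i)))
    (h₂ : ∀ i : ℕ, 0 < i → i ≤ t →
      Subsingleton (Ext.{v} N ((Φ.localCohomology (t - i)).obj M) (s + 1 + i)))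
    (h₃ : ∀ i : ℕ, 0 < i → i < s →
      Subsingleton (Ext.{v} N ((Φ.localCohomology (t + i)).obj M) (s - 1 - i))) :
    Nonempty (Ext.{v} N M (s + t) ≃ₗ[R] Ext.{v} N ((Φ.localCohomology t).obj M) s) := by
  refine nonempty_ext_equiv_ext_rightDerived R Φ.torsionInclusion
    (Φ.bijective_comp_torsionInclusion hN) M s t (fun a q ha hq => ?_) (fun a q ha hq => ?_)
    fun a q ha hq => ?_
  · obtain rfl : a = s + t - q := by lia
    exact h₁ q (by lia)
  · obtain ⟨i, rfl⟩ : ∃ i, t = q + i := ⟨t - q, by lia⟩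
    obtain rfl : a = s + 1 + i := by lia
    have h := h₂ i (by lia) (by lia)
    rwa [Nat.add_sub_cancel] at h
  · obtain ⟨i, rfl⟩ : ∃ i, q = t + i := ⟨q - t, by lia⟩
    obtain rfl : a = s - 1 - i := by lia
    exact h₃ i (by lia) (by lia)

theorem theorem4p4 {R : Type u} [CommRing R] [IsNoetherianRing R] [Small.{v} R]
    (Φ : SystemOfIdeals R) (N M : ModuleCat.{v} R) [Module.Finite R N] (hN : Φ.IsTorsion N)
    (s t : ℕ)
    (h₁ : ∀ i : ℕ, (i < t ∨ (t + 1 ≤ i ∧ i ≤ s + t)) →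
      Subsingleton (Abelian.Ext.{v} N ((Φ.localCohomology i).obj M) (s + t - i)))
    (h₂ : ∀ i : ℕ, i ≤ t →
      Subsingleton (Abelian.Ext.{v} N ((Φ.localCohomology (t - i)).obj M) (s + 1 + i)))
    (h₃ : ∀ i : ℕ, i < s →
      Subsingleton (Abelian.Ext.{v} N ((Φ.localCohomology (t + i)).obj M) (s - 1 - i))) :
    Nonempty (Abelian.Ext.{v} N M (s + t) ≃ₗ[R]
      Abelian.Ext.{v} N ((Φ.localCohomology t).obj M) s) :=
  theorem4p4_general Φ N M hN s t h₁ (fun i _ => h₂ i) fun i _ => h₃ i
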